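/- For $t>0$, $\beta>-1$ and $\alpha>-1$ let $$\mu(t,\beta,\alpha)=\frac1{\Gamma(\beta+1)}\int_0^\infty \frac{t^{u+\alpha}u^\beta}{\Gamma(u+\alpha+1)}\,du$$ be the Volterra function, and let $\nu(t)=\mu(t,0,0)$. For $k\in\mathbb N=\{0,1,2,\dots\}$ let $$\mathcal M(s,k,\alpha)=\frac{1}{s^{\alpha+1}(\operatorname{Ln} s)^{k+1}},$$ with the principal branches of the power and of the logarithm (cut along $(-\infty,0]$); this is the analytic continuation of the Laplace transform of $\mu(\cdot,k,\alpha)$. **Theorem.** Let $k\in\mathbb N$ and $-1<\alpha\le 0$. There is a real polynomial $P_k$ of degree exactly $k$, with coefficients depending on $\alpha$, such that $$\operatorname{Res}_{s=1}\bigl(e^{st}\mathcal M(s,k,\alpha)\bigr)=\frac{e^t}{k!}P_k(t)\qquad(t\in\mathbb R),$$ which determines $P_k$ uniquely, and for every $t>0$ $$\mu(t,k,\alpha)=\frac{e^t}{k!}P_k(t)-N_k(t,\alpha),$$ where $$N_k(t,\alpha)=\frac1\pi\int_0^\infty\frac{e^{-rt}\,\sin\bigl[\alpha\pi+(k+1)\operatorname{Arg}(\ln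 r+i\pi)\bigr]}{r^{\alpha+1}\bigl[(\ln r)^2+\pi^2\bigr]^{\frac{k+1}2}}\,dr,\qquad -\pi<\operatorname{Arg}\le\pi,$$ and the integrals defining $\mu(t,k,\alpha)$ and $N_k(t,\alpha)$ converge absolutely. In particular, for $k=0$ and $\alpha=0$ and every $t>0$, $$N_0(t,0)=N(t):=\int_0^\infty\frac{e^{-rt}}{r\,[(\ln r)^2+\pi^2]}\,dr$$ and Ramanujan's identity $\nu(t)=e^t-N(t)$ holds. -/

import Mathlib

open MeasureTheory Set

noncomputable section

/-- Integrand of the Volterra function `μ(t, β, α)`, as a function of `u`. -/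
def volterraIntegrand (t β α u : ℝ) : ℝ :=
  t ^ (u + α) * u ^ β / Real.Gamma (u + α + 1)

/-- The Volterra function
`μ(t, β, α) = (1 / Γ(β + 1)) ∫₀^∞ t^(u + α) u^β / Γ(u + α + 1) du`. -/
def volterraMu (t β α : ℝ) : ℝ :=
  1 / Real.Gamma (β + 1) * ∫ u in Ioi (0 : ℝ), volterraIntegrand t β α u

/-- The special Volterra function `ν(t) = μ(t, 0, 0)`. -/
def volterraNu (t : ℝ) : ℝ := volterraMu t 0 0

/-- The function `M(s, k, α) = 1 / (s^(α + 1) (Ln s)^(k + 1))`, with principal branches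
(cut along `(-∞, 0]`): the Laplace transform of `μ(·, k, α)`, continued analytically. -/
def volterraLaplace (s : ℂ) (k : ℕ) (α : ℝ) : ℂ :=
  1 / (s ^ ((α : ℂ) + 1) * Complex.log s ^ (k + 1))

/-- `f` is holomorphic on a punctured disc around `z₀`, and its residue at `z₀` is `a`. -/
def HasResidueAt (f : ℂ → ℂ) (z₀ a : ℂ) : Prop :=
  ∃ R : ℝ, 0 < R ∧ DifferentiableOn ℂ f (Metric.ball z₀ R \ {z₀}) ∧
    ∀ r : ℝ, 0 < r → r < R →
      (2 * (Real.pi : ℂ) * Complex.I)⁻¹ * (∮ z in C(z₀, r), f z) = a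

/-- Integrand of the generalized Ramanujan function `N_k(t, α)`, as a function of `r`. -/
def ramanujanIntegrand (k : ℕ) (t α r : ℝ) : ℝ :=
  Real.exp (-(r * t)) *
      Real.sin (α * Real.pi +
        ((k : ℝ) + 1) * Complex.arg ((Real.log r : ℂ) + Complex.I * (Real.pi : ℂ))) /
    (r ^ (α + 1) * (Real.log r ^ 2 + Real.pi ^ 2) ^ (((k : ℝ) + 1) / 2))

/-- The generalized Ramanujan function `N_k(t, α)`. -/
def generalizedRamanujanN (k : ℕ) (t α : ℝ) : ℝ :=
  1 / Real.pi * ∫ r in Ioi (0 : ℝ), ramanujanIntegrand k t α r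

/-- The Ramanujan function `N(t) = ∫₀^∞ e^(-r t) / (r ((ln r)² + π²)) dr`. -/
def ramanujanN (t : ℝ) : ℝ :=
  ∫ r in Ioi (0 : ℝ), Real.exp (-(r * t)) / (r * (Real.log r ^ 2 + Real.pi ^ 2))

end

/-! The identity is proved without inverting a Laplace transform. Let `F_k` stand for any of
μ(t,k,α), N_k(t,α) and e^t P_k(t)/k!. All three families satisfy t F_k' = α F_k + (k+1) F_{k+1}: the
first by differentiation under the integral (`hasDerivAt_volterraMu`), the second by an integration
by parts in r (`hasDerivAt_generalizedRamanujanN`), the third by the recursion in `residuePoly`.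
That this recursion does produce the residues follows from integrating an exact derivative around s
= 1 (`circleIntegral_volterraLaplace_succ`). Thus F_k determines F_{k+1}, and induction on k
(`volterraMu_eq`) leaves only k = 0.

For k = 0 the sum μ(t,0,α) + N_0(t,α) is independent of α in [-1,0]: a change of α alters μ by an
integral of t^v/Γ(v+1) over v, which the reflection formula and Fubini turn into the opposite change
of N_0 (`volterraMu_zero_add_generalizedRamanujanN`). The t-derivative of the sum at α = 0 is the
sum at α = -1, hence the sum itself. It therefore solves f' = f, and f → 1 as t → 0+, so f = e^t
(`volterraMu_zero_zero`). -/

open Filter Topology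

/-! ### Residues at s = 1 and their polynomials. -/

/-- The polynomials `P_k` of the residues of `e^(st) s^(-α-1) (Ln s)^(-k-1)` at `1`. -/
noncomputable def residuePoly (α : ℝ) : ℕ → Polynomial ℝ
  | 0 => 1
  | k + 1 => Polynomial.X * (residuePoly α k + (residuePoly α k).derivative) -
      Polynomial.C α * residuePoly α k

/-- Differentiating e^{st} in t brings down a factor s, which lowers α by one; on the residue side
this is (e^t P)' = e^t (P + P'). It removes the shifted exponent α - 1 from the recursion for the
contour integrals. -/
theorem residuePoly_sub_one (α : ℝ) (k : ℕ) :
    residuePoly (α - 1) k = residuePoly α k + (residuePoly α k).derivative := by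
  induction k with
  | zero => simp [residuePoly]
  | succ k ih =>
    simp only [residuePoly, ih, Polynomial.derivative_mul,
      Polynomial.derivative_add, Polynomial.derivative_X, Polynomial.derivative_C, map_sub, map_one]
    ring

theorem degree_residuePoly (α : ℝ) (k : ℕ) :
    (residuePoly α k).degree = (k : WithBot ℕ) := by
  induction k with
  | zero => simp [residuePoly]
  | succ k ih =>
    have hne : residuePoly α k ≠ 0 := by
      intro h
      rw [h, Polynomial.degree_zero] at ih
      exact absurd ih.symm (WithBot.natCast_ne_bot k)
    have h1 : (residuePoly α k + (residuePoly α k).derivative).degree = k := by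
      rw [Polynomial.degree_add_eq_left_of_degree_lt (Polynomial.degree_derivative_lt hne), ih]
    have h2 : (Polynomial.X * (residuePoly α k + (residuePoly α k).derivative)).degree =
        ((k + 1 : ℕ) : WithBot ℕ) := by
      rw [Polynomial.degree_mul, h1, Polynomial.degree_X, add_comm]
      rfl
    rw [residuePoly, Polynomial.degree_sub_eq_left_of_degree_lt, h2]
    rw [h2]
    rw [← Polynomial.smul_eq_C_mul]
    refine (Polynomial.degree_smul_le _ _).trans_lt ?_
    rw [ih]
    exact_mod_cast Nat.lt_succ_self k

theorem mem_slitPlane_of_mem_ball_one {s : ℂ} (hs : s ∈ Metric.ball (1 : ℂ) 1) :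
    s ∈ Complex.slitPlane := by
  left
  have h := (Complex.abs_re_le_norm (s - 1)).trans_lt (mem_ball_iff_norm.1 hs)
  have := (abs_lt.1 h).1
  simp only [Complex.sub_re, Complex.one_re] at this
  linarith

theorem Complex.log_ne_zero_of_mem_slitPlane {s : ℂ} (hs : s ∈ Complex.slitPlane) (h1 : s ≠ 1) :
    Complex.log s ≠ 0 := by
  intro h
  apply h1
  rw [← Complex.exp_log (Complex.slitPlane_ne_zero hs), h, Complex.exp_zero]

/-- The primitive is single-valued on the punctured disc about 1, so this combination of three
integrands has zero integral over small circles. -/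
theorem hasDerivAt_exp_mul_cpow_div_log_pow (k : ℕ) (α t : ℝ) {s : ℂ}
    (hs : s ∈ Complex.slitPlane) (h1 : s ≠ 1) :
    HasDerivAt (fun s : ℂ => Complex.exp (s * t) * s ^ (-(α : ℂ)) / Complex.log s ^ (k + 1))
      (t * (Complex.exp (s * t) * volterraLaplace s k (α - 1)) -
        α * (Complex.exp (s * t) * volterraLaplace s k α) -
        (k + 1) * (Complex.exp (s * t) * volterraLaplace s (k + 1) α)) s := by
  have hl := Complex.log_ne_zero_of_mem_slitPlane hs h1
  have h0 := Complex.slitPlane_ne_zero hs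
  have hd1 : HasDerivAt (fun s : ℂ => Complex.exp (s * t)) (Complex.exp (s * t) * t) s := by
    simpa using ((hasDerivAt_id s).mul_const (t : ℂ)).cexp
  have hd2 := (hasDerivAt_id s).cpow_const (c := -(α : ℂ)) hs
  have hd3 := (Complex.hasDerivAt_log hs).pow (k + 1)
  refine ((hd1.mul hd2).div hd3 (pow_ne_zero _ hl)).congr_deriv ?_
  have e1 : s ^ ((α : ℂ) + 1) = s * s ^ (α : ℂ) := by
    rw [Complex.cpow_add _ _ h0, Complex.cpow_one, mul_comm]
  have e2 : s ^ (-(α : ℂ) - 1) = (s * s ^ (α : ℂ))⁻¹ := by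
    rw [← e1, ← Complex.cpow_neg]; ring_nf
  have e3 : s ^ (((α - 1 : ℝ) : ℂ) + 1) = s ^ (α : ℂ) := by push_cast; ring_nf
  have hp : s ^ (α : ℂ) ≠ 0 := by simp [Complex.cpow_eq_zero_iff, h0]
  simp only [volterraLaplace, e3, e1, Pi.mul_apply, Pi.pow_apply, id, e2, Complex.cpow_neg,
    add_tsub_cancel_right]
  field_simp
  push_cast
  ring

theorem sphere_subset_slitPlane {r : ℝ} (hr0 : 0 < r) (hr : r < 1) {s : ℂ}
    (hs : s ∈ Metric.sphere (1 : ℂ) r) : s ∈ Complex.slitPlane ∧ s ≠ 1 := by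
  rw [mem_sphere_iff_norm] at hs
  refine ⟨mem_slitPlane_of_mem_ball_one (mem_ball_iff_norm.2 (hs ▸ hr)), ?_⟩
  rintro rfl
  simp at hs
  exact hr0.ne hs

theorem differentiableAt_exp_mul_volterraLaplace (k : ℕ) (α t : ℝ) {s : ℂ}
    (hs : s ∈ Complex.slitPlane) (h1 : s ≠ 1) :
    DifferentiableAt ℂ (fun s : ℂ => Complex.exp (s * t) * volterraLaplace s k α) s := by
  have hl := Complex.log_ne_zero_of_mem_slitPlane hs h1
  have h0 := Complex.slitPlane_ne_zero hs
  have hp : s ^ ((α : ℂ) + 1) ≠ 0 := by simp [Complex.cpow_eq_zero_iff, h0]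
  unfold volterraLaplace
  refine DifferentiableAt.mul (by fun_prop) ((differentiableAt_const _).div ?_ ?_)
  · exact (differentiableAt_id.cpow_const hs).mul ((Complex.differentiableAt_log hs).pow _)
  · exact mul_ne_zero hp (pow_ne_zero _ hl)

theorem circleIntegrable_exp_mul_volterraLaplace (k : ℕ) (α t : ℝ) {r : ℝ} (hr0 : 0 < r)
    (hr : r < 1) :
    CircleIntegrable (fun s : ℂ => Complex.exp (s * t) * volterraLaplace s k α) 1 r := by
  refine ContinuousOn.circleIntegrable hr0.le fun s hs => ?_
  obtain ⟨h, h1⟩ := sphere_subset_slitPlane hr0 hr hs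
  exact (differentiableAt_exp_mul_volterraLaplace k α t h h1).continuousAt.continuousWithinAt

theorem circleIntegral_volterraLaplace_succ (k : ℕ) (α t : ℝ) {r : ℝ} (hr0 : 0 < r) (hr : r < 1) :
    ((k : ℂ) + 1) * (∮ s in C(1, r), Complex.exp (s * t) * volterraLaplace s (k + 1) α) =
      t * (∮ s in C(1, r), Complex.exp (s * t) * volterraLaplace s k (α - 1)) -
        α * (∮ s in C(1, r), Complex.exp (s * t) * volterraLaplace s k α) := by
  have h := circleIntegral.integral_eq_zero_of_hasDerivWithinAt hr0.le fun s hs =>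
    (hasDerivAt_exp_mul_cpow_div_log_pow k α t (sphere_subset_slitPlane hr0 hr hs).1
      (sphere_subset_slitPlane hr0 hr hs).2).hasDerivWithinAt
  have i1 := circleIntegrable_exp_mul_volterraLaplace k (α - 1) t hr0 hr
  have i2 := circleIntegrable_exp_mul_volterraLaplace k α t hr0 hr
  have i3 := circleIntegrable_exp_mul_volterraLaplace (k + 1) α t hr0 hr
  have j1 : CircleIntegrable (fun s : ℂ =>
      t * (Complex.exp (s * t) * volterraLaplace s k (α - 1))) 1 r := i1.const_smul (a := (t : ℂ))
  have j2 : CircleIntegrable (fun s : ℂ =>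
      α * (Complex.exp (s * t) * volterraLaplace s k α)) 1 r := i2.const_smul (a := (α : ℂ))
  have j3 : CircleIntegrable (fun s : ℂ =>
      ((k : ℂ) + 1) * (Complex.exp (s * t) * volterraLaplace s (k + 1) α)) 1 r :=
    i3.const_smul (a := (k : ℂ) + 1)
  have j12 : CircleIntegrable (fun s : ℂ => t * (Complex.exp (s * t) * volterraLaplace s k (α - 1)) -
      α * (Complex.exp (s * t) * volterraLaplace s k α)) 1 r := j1.sub j2
  rw [circleIntegral.integral_sub j12 j3, circleIntegral.integral_sub j1 j2,
    circleIntegral.integral_const_mul, circleIntegral.integral_const_mul,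
    circleIntegral.integral_const_mul] at h
  linear_combination -h

/-- The pole is simple: log s / (s - 1) extends holomorphically to s = 1 with value 1 (this is
`dslope`), and Cauchy's formula evaluates the integral. -/
theorem circleIntegral_volterraLaplace_zero (α t : ℝ) {r : ℝ} (hr0 : 0 < r) (hr : r < 1) :
    (∮ s in C(1, r), Complex.exp (s * t) * volterraLaplace s 0 α) =
      2 * Real.pi * Complex.I * Complex.exp t := by
  set q : ℂ → ℂ := fun s =>
    Complex.exp (s * t) / (s ^ ((α : ℂ) + 1) * dslope Complex.log 1 s) with hq
  have hball : ∀ s ∈ Metric.closedBall (1 : ℂ) r, s ∈ Complex.slitPlane := fun s hs =>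
    mem_slitPlane_of_mem_ball_one (Metric.closedBall_subset_ball hr hs)
  have hds1 : dslope Complex.log 1 1 = 1 := by
    rw [dslope_same, (Complex.hasDerivAt_log Complex.one_mem_slitPlane).deriv, inv_one]
  have hds : ∀ s : ℂ, s ≠ 1 → dslope Complex.log 1 s = (s - 1)⁻¹ * Complex.log s := by
    intro s hs
    rw [dslope_of_ne _ hs, slope_def_module]
    simp
  have hdd : DifferentiableOn ℂ (dslope Complex.log 1) (Metric.ball 1 1) := by
    rw [Complex.differentiableOn_dslope (Metric.ball_mem_nhds _ one_pos)]
    exact fun s hs => (Complex.differentiableAt_log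
      (mem_slitPlane_of_mem_ball_one hs)).differentiableWithinAt
  have hqd : ∀ s ∈ Metric.closedBall (1 : ℂ) r, DifferentiableAt ℂ q s := by
    intro s hs
    have hsp := hball s hs
    have hsb := Metric.closedBall_subset_ball hr hs
    have hp : s ^ ((α : ℂ) + 1) ≠ 0 := by
      simp [Complex.cpow_eq_zero_iff, Complex.slitPlane_ne_zero hsp]
    have hn : dslope Complex.log 1 s ≠ 0 := by
      by_cases h1 : s = 1
      · rw [h1, hds1]; exact one_ne_zero
      · rw [hds s h1]
        exact mul_ne_zero (inv_ne_zero (sub_ne_zero.2 h1))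
          (Complex.log_ne_zero_of_mem_slitPlane hsp h1)
    refine DifferentiableAt.div (by fun_prop) ?_ (mul_ne_zero hp hn)
    exact (differentiableAt_id.cpow_const hsp).mul
      ((hdd s hsb).differentiableAt (Metric.isOpen_ball.mem_nhds hsb))
  have hcauchy := Complex.circleIntegral_sub_inv_smul_of_differentiable_on_off_countable
    (countable_empty) (Metric.mem_ball_self hr0)
    (fun s hs => (hqd s hs).continuousAt.continuousWithinAt)
    (fun s hs => hqd s (Metric.ball_subset_closedBall hs.1))
  have hq1 : q 1 = Complex.exp t := by simp only [hq, hds1]; simp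
  rw [hq1, smul_eq_mul] at hcauchy
  rw [← hcauchy]
  refine circleIntegral.integral_congr hr0.le fun s hs => ?_
  obtain ⟨h, h1⟩ := sphere_subset_slitPlane hr0 hr hs
  have h2 : s - 1 ≠ 0 := sub_ne_zero.2 h1
  have hl := Complex.log_ne_zero_of_mem_slitPlane h h1
  have hp : s ^ ((α : ℂ) + 1) ≠ 0 := by
    simp [Complex.cpow_eq_zero_iff, Complex.slitPlane_ne_zero h]
  simp only [hq, hds s h1, volterraLaplace, smul_eq_mul, zero_add, pow_one]
  field_simp

theorem circleIntegral_volterraLaplace (k : ℕ) (α t : ℝ) {r : ℝ} (hr0 : 0 < r) (hr : r < 1) :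
    (∮ s in C(1, r), Complex.exp (s * t) * volterraLaplace s k α) =
      2 * Real.pi * Complex.I *
        ((Real.exp t / k.factorial * (residuePoly α k).eval t : ℝ) : ℂ) := by
  induction k generalizing α with
  | zero =>
    rw [circleIntegral_volterraLaplace_zero α t hr0 hr]
    simp [residuePoly]
  | succ k ih =>
    have hk : ((k : ℂ) + 1) ≠ 0 := Nat.cast_add_one_ne_zero k
    have hf : (k.factorial : ℂ) ≠ 0 := Nat.cast_ne_zero.2 k.factorial_ne_zero
    apply mul_left_cancel₀ hk
    rw [circleIntegral_volterraLaplace_succ k α t hr0 hr, ih, ih, residuePoly_sub_one]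
    simp only [residuePoly, Nat.factorial_succ, Polynomial.eval_sub, Polynomial.eval_mul,
      Polynomial.eval_add, Polynomial.eval_X, Polynomial.eval_C]
    push_cast
    field_simp

theorem hasResidueAt_exp_mul_volterraLaplace (k : ℕ) (α t : ℝ) :
    HasResidueAt (fun s : ℂ => Complex.exp (s * (t : ℂ)) * volterraLaplace s k α) 1
      ((Real.exp t / (k.factorial : ℝ) * (residuePoly α k).eval t : ℝ) : ℂ) := by
  refine ⟨1, one_pos, fun s hs => ?_, fun r hr0 hr => ?_⟩
  · exact (differentiableAt_exp_mul_volterraLaplace k α t (mem_slitPlane_of_mem_ball_one hs.1)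
      hs.2).differentiableWithinAt
  · rw [circleIntegral_volterraLaplace k α t hr0 hr]
    exact inv_mul_cancel_left₀ Complex.two_pi_I_ne_zero _

/-! ### The Volterra integral: convergence and differentiation in t. -/

/-- Keep only the part s > A of the integral for Γ(x+1), where s^x ≥ A^x. Since A is free, 1/Γ
decays faster than any given exponential. -/
theorem Real.one_div_Gamma_le {A x : ℝ} (hA : 0 < A) (hx : 0 < x) :
    1 / Real.Gamma x ≤ x * Real.exp A * A ^ (-x) := by
  have hx1 : 0 < x + 1 := by linarith
  have hint := Real.GammaIntegral_convergent hx1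
  have hle : A ^ x * Real.exp (-A) ≤ Real.Gamma (x + 1) := by
    rw [Real.Gamma_eq_integral hx1]
    calc A ^ x * Real.exp (-A) = ∫ s in Ioi A, Real.exp (-s) * A ^ x := by
          rw [integral_mul_const, integral_exp_neg_Ioi, mul_comm]
      _ ≤ ∫ s in Ioi A, Real.exp (-s) * s ^ (x + 1 - 1) := by
          refine setIntegral_mono_on ((integrableOn_exp_neg_Ioi A).mul_const _)
            (hint.mono_set (Ioi_subset_Ioi hA.le)) measurableSet_Ioi fun s hs => ?_
          rw [add_sub_cancel_right]
          exact mul_le_mul_of_nonneg_left (Real.rpow_le_rpow hA.le (le_of_lt hs) hx.le)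
            (Real.exp_pos _).le
      _ ≤ _ := by
          refine setIntegral_mono_set hint ?_ (Ioi_subset_Ioi hA.le).eventuallyLE
          filter_upwards [ae_restrict_mem measurableSet_Ioi] with s hs
          exact mul_nonneg (Real.exp_pos _).le (Real.rpow_nonneg (le_of_lt hs) _)
  rw [Real.Gamma_add_one hx.ne'] at hle
  have hG := Real.Gamma_pos_of_pos hx
  rw [div_le_iff₀ hG]
  calc (1 : ℝ) = A ^ x * Real.exp (-A) * (Real.exp A * A ^ (-x)) := by
        rw [Real.rpow_neg hA.le, Real.exp_neg]
        have := (Real.rpow_pos_of_pos hA x).ne'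
        field_simp
    _ ≤ x * Real.Gamma x * (Real.exp A * A ^ (-x)) := by gcongr
    _ = _ := by ring

theorem continuousOn_volterraIntegrand {t α : ℝ} (β : ℝ) (ht : 0 < t) (hα : -1 ≤ α) :
    ContinuousOn (volterraIntegrand t β α) (Ioi 0) := by
  intro u hu
  have hu' : 0 < u := hu
  have hG : ContinuousAt Real.Gamma (u + α + 1) :=
    (Real.differentiableAt_Gamma fun m => by
      have : (0 : ℝ) ≤ m := Nat.cast_nonneg m
      linarith).continuousAt
  have hG' : ContinuousAt (fun u => Real.Gamma (u + α + 1)) u :=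
    ContinuousAt.comp (f := fun u => u + α + 1) hG (by fun_prop)
  refine ContinuousAt.continuousWithinAt (ContinuousAt.div (ContinuousAt.mul ?_ ?_) hG' ?_)
  · exact ContinuousAt.rpow continuousAt_const (by fun_prop) (Or.inl ht.ne')
  · exact Real.continuousAt_rpow_const _ _ (Or.inl hu'.ne')
  · exact (Real.Gamma_pos_of_pos (by linarith)).ne'

theorem volterraIntegrand_nonneg {t α u : ℝ} (β : ℝ) (ht : 0 < t) (hα : -1 ≤ α) (hu : 0 < u) :
    0 ≤ volterraIntegrand t β α u :=
  div_nonneg (mul_nonneg (Real.rpow_nonneg ht.le _) (Real.rpow_nonneg hu.le _))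
    (Real.Gamma_pos_of_pos (by linarith)).le

theorem volterraIntegrand_le {t α u : ℝ} (β : ℝ) (ht : 0 < t) (hα : -1 ≤ α) (hu : 0 < u) :
    volterraIntegrand t β α u ≤
      t⁻¹ * Real.exp (Real.exp 1 * t) * Real.exp (-(α + 1)) *
        (Real.exp (-u) * u ^ (β + 2 - 1) + (α + 1) * (Real.exp (-u) * u ^ (β + 1 - 1))) := by
  have hx : 0 < u + α + 1 := by linarith
  -- With A = e·t the power of t cancels and a factor e^{-u} remains, so the bound is a combination
  -- of Gamma integrands.
  have h := Real.one_div_Gamma_le (mul_pos (Real.exp_pos 1) ht) hx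
  have e1 : (Real.exp 1 * t) ^ (-(u + α + 1)) =
      Real.exp (-u) * Real.exp (-(α + 1)) * (t ^ (u + α) * t)⁻¹ := by
    rw [Real.mul_rpow (Real.exp_pos 1).le ht.le, Real.exp_one_rpow, ← Real.exp_add,
      Real.rpow_neg ht.le, Real.rpow_add_one ht.ne']
    ring_nf
  have e2 : u ^ (β + 2 - 1) = u ^ β * u := by
    rw [← Real.rpow_add_one hu.ne']; ring_nf
  have e3 : u ^ (β + 1 - 1) = u ^ β := by ring_nf
  have hp := (Real.rpow_pos_of_pos ht (u + α)).ne'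
  calc volterraIntegrand t β α u = t ^ (u + α) * u ^ β * (1 / Real.Gamma (u + α + 1)) := by
        rw [volterraIntegrand]; ring
    _ ≤ t ^ (u + α) * u ^ β * ((u + α + 1) * Real.exp (Real.exp 1 * t) *
        (Real.exp 1 * t) ^ (-(u + α + 1))) := by
        gcongr
    _ = _ := by
        rw [e1, e2, e3]
        field_simp
        ring

theorem integrableOn_volterraIntegrand {t α β : ℝ} (ht : 0 < t) (hβ : -1 < β) (hα : -1 ≤ α) :
    IntegrableOn (volterraIntegrand t β α) (Ioi 0) := by
  have i1 := Real.GammaIntegral_convergent (s := β + 2) (by linarith)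
  have i2 := Real.GammaIntegral_convergent (s := β + 1) (by linarith)
  refine Integrable.mono' ((i1.add (i2.const_mul (α + 1))).const_mul
    (t⁻¹ * Real.exp (Real.exp 1 * t) * Real.exp (-(α + 1))))
    ((continuousOn_volterraIntegrand β ht hα).aestronglyMeasurable measurableSet_Ioi) ?_
  filter_upwards [ae_restrict_mem measurableSet_Ioi] with u hu
  rw [Real.norm_of_nonneg (volterraIntegrand_nonneg β ht hα hu)]
  exact volterraIntegrand_le β ht hα hu

/-- A power of t is monotone in t, in a direction depending on the sign of u + α; the sum of the
endpoint values covers both cases and gives a dominating function uniform in t. -/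
theorem volterraIntegrand_le_add {t a b : ℝ} (β : ℝ) {α u : ℝ} (ha : 0 < a) (hat : a ≤ t)
    (htb : t ≤ b) (hα : -1 ≤ α) (hu : 0 < u) :
    volterraIntegrand t β α u ≤ volterraIntegrand a β α u + volterraIntegrand b β α u := by
  have ht : 0 < t := ha.trans_le hat
  have hx : t ^ (u + α) ≤ a ^ (u + α) + b ^ (u + α) := by
    have h1 := Real.rpow_nonneg ha.le (u + α)
    have h2 := Real.rpow_nonneg (ht.le.trans htb) (u + α)
    rcases le_total 0 (u + α) with h | h
    · linarith [Real.rpow_le_rpow ht.le htb h]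
    · linarith [Real.rpow_le_rpow_of_nonpos ha hat h]
  have hG := Real.Gamma_pos_of_pos (show 0 < u + α + 1 by linarith)
  have hub := Real.rpow_nonneg hu.le β
  simp only [volterraIntegrand]
  rw [← add_div, ← add_mul]
  gcongr

theorem hasDerivAt_volterraIntegrand {t u : ℝ} (β α : ℝ) (ht : 0 < t) (hu : 0 < u) :
    HasDerivAt (fun t => volterraIntegrand t β α u)
      (t⁻¹ * (volterraIntegrand t (β + 1) α u + α * volterraIntegrand t β α u)) t := by
  have h := ((Real.hasDerivAt_rpow_const (p := u + α) (Or.inl ht.ne')).mul_const (u ^ β)).div_const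
    (Real.Gamma (u + α + 1))
  refine h.congr_deriv ?_
  simp only [volterraIntegrand]
  rw [Real.rpow_sub_one ht.ne', Real.rpow_add_one hu.ne']
  ring

/-- The exponent u + α comes down: the factor u raises β by one, and Γ(β+2) = (β+1) Γ(β+1) accounts
for the coefficient. -/
theorem hasDerivAt_volterraMu {t α β : ℝ} (ht : 0 < t) (hβ : -1 < β) (hα : -1 ≤ α) :
    HasDerivAt (fun t => volterraMu t β α)
      (t⁻¹ * ((β + 1) * volterraMu t (β + 1) α + α * volterraMu t β α)) t := by
  have hβ1 : -1 < β + 1 := by linarith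
  have ha : 0 < t / 2 := by linarith
  have hb : 0 < 2 * t := by linarith
  have ia := integrableOn_volterraIntegrand ha hβ hα
  have ib := integrableOn_volterraIntegrand hb hβ hα
  have ia1 := integrableOn_volterraIntegrand ha hβ1 hα
  have ib1 := integrableOn_volterraIntegrand hb hβ1 hα
  have key := hasDerivAt_integral_of_dominated_loc_of_deriv_le (μ := volume.restrict (Ioi 0))
    (F := fun t u => volterraIntegrand t β α u)
    (F' := fun t u =>
      t⁻¹ * (volterraIntegrand t (β + 1) α u + α * volterraIntegrand t β α u))
    (bound := fun u => (t / 2)⁻¹ *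
      ((volterraIntegrand (t / 2) (β + 1) α u + volterraIntegrand (2 * t) (β + 1) α u) +
        |α| * (volterraIntegrand (t / 2) β α u + volterraIntegrand (2 * t) β α u)))
    (x₀ := t) (s := Icc (t / 2) (2 * t)) (Icc_mem_nhds (by linarith) (by linarith))
    (by
      filter_upwards [lt_mem_nhds ht] with s hs
      exact (continuousOn_volterraIntegrand β hs hα).aestronglyMeasurable measurableSet_Ioi)
    (integrableOn_volterraIntegrand ht hβ hα)
    (((integrableOn_volterraIntegrand ht hβ1 hα).add
      ((integrableOn_volterraIntegrand ht hβ hα).const_mul α)).const_mul t⁻¹).aestronglyMeasurable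
    (by
      filter_upwards [ae_restrict_mem measurableSet_Ioi] with u hu s hs
      have hs0 : 0 < s := ha.trans_le hs.1
      have hn := volterraIntegrand_nonneg β hs0 hα hu
      have hn1 := volterraIntegrand_nonneg (β + 1) hs0 hα hu
      rw [norm_mul, norm_inv, Real.norm_of_nonneg hs0.le]
      refine mul_le_mul (inv_anti₀ ha hs.1) ?_ (norm_nonneg _) (inv_nonneg.2 ha.le)
      refine (norm_add_le _ _).trans ?_
      rw [norm_mul, Real.norm_of_nonneg hn, Real.norm_of_nonneg hn1, Real.norm_eq_abs]
      exact add_le_add (volterraIntegrand_le_add _ ha hs.1 hs.2 hα hu)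
        (mul_le_mul_of_nonneg_left (volterraIntegrand_le_add _ ha hs.1 hs.2 hα hu) (abs_nonneg α)))
    (((ia1.add ib1).add ((ia.add ib).const_mul |α|)).const_mul (t / 2)⁻¹)
    (by
      filter_upwards [ae_restrict_mem measurableSet_Ioi] with u hu s hs
      exact hasDerivAt_volterraIntegrand β α (ha.trans_le hs.1) hu)
  refine (key.2.const_mul (1 / Real.Gamma (β + 1))).congr_deriv ?_
  rw [integral_const_mul, integral_add (integrableOn_volterraIntegrand ht hβ1 hα)
    ((integrableOn_volterraIntegrand ht hβ hα).const_mul α), integral_const_mul]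
  simp only [volterraMu]
  have hne : β + 1 ≠ 0 := by linarith
  have hG := (Real.Gamma_pos_of_pos (show 0 < β + 1 by linarith)).ne'
  rw [Real.Gamma_add_one hne]
  field_simp

/-! ### The kernel of N_k as an imaginary part. -/

/-- The factor `Im (e^(-α w) / w^(k+1))`, `w = ln r - iπ`, of the integrand of `N_k(t, α)`. -/
noncomputable def ramanujanKernel (k : ℕ) (α r : ℝ) : ℝ :=
  (Complex.exp (-(α : ℂ) * (Real.log r - Real.pi * Complex.I)) /
    (Real.log r - Real.pi * Complex.I) ^ (k + 1)).im

theorem ofReal_sub_pi_mul_I_ne_zero (x : ℝ) : ((x : ℂ) - Real.pi * Complex.I) ≠ 0 := by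
  intro h
  have := congrArg Complex.im h
  simp at this

theorem normSq_ofReal_sub_pi_mul_I (x : ℝ) :
    Complex.normSq ((x : ℂ) - Real.pi * Complex.I) = x ^ 2 + Real.pi ^ 2 := by
  simp [Complex.normSq_apply]; ring

theorem pi_le_norm_ofReal_sub_pi_mul_I (x : ℝ) :
    Real.pi ≤ ‖(x : ℂ) - Real.pi * Complex.I‖ := by
  have := Complex.abs_im_le_norm ((x : ℂ) - Real.pi * Complex.I)
  simpa [abs_of_pos Real.pi_pos] using this

theorem abs_le_norm_ofReal_sub_pi_mul_I (x : ℝ) :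
    |x| ≤ ‖(x : ℂ) - Real.pi * Complex.I‖ := by
  have := Complex.abs_re_le_norm ((x : ℂ) - Real.pi * Complex.I)
  simpa using this

theorem im_inv_ofReal_sub_pi_mul_I (x : ℝ) :
    (((x : ℂ) - Real.pi * Complex.I)⁻¹).im = Real.pi / (x ^ 2 + Real.pi ^ 2) := by
  rw [Complex.inv_im, normSq_ofReal_sub_pi_mul_I]
  simp

theorem norm_exp_neg_mul_log_sub_pi_mul_I (α : ℝ) {r : ℝ} (hr : 0 < r) :
    ‖Complex.exp (-(α : ℂ) * (Real.log r - Real.pi * Complex.I))‖ = r ^ (-α) := by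
  rw [Complex.norm_exp, Real.rpow_def_of_pos hr]
  congr 1
  simp
  ring

/-- With w = ln r - iπ, the conjugate of ln r + iπ, one has w⁻¹ = e^{iθ}/|w| and e^{-αw} = r^{-α}
e^{iαπ}. The complex form makes derivatives in r and in α immediate. -/
theorem ramanujanIntegrand_eq (k : ℕ) (t α : ℝ) {r : ℝ} (hr : 0 < r) :
    ramanujanIntegrand k t α r = Real.exp (-(r * t)) / r * ramanujanKernel k α r := by
  set z : ℂ := (Real.log r : ℂ) + Complex.I * (Real.pi : ℂ) with hz
  set w : ℂ := (Real.log r : ℂ) - Real.pi * Complex.I with hw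
  set θ := Complex.arg z
  have hw0 : w ≠ 0 := ofReal_sub_pi_mul_I_ne_zero _
  have hns : ‖w‖ ^ 2 = Real.log r ^ 2 + Real.pi ^ 2 := by
    rw [← Complex.normSq_eq_norm_sq]; exact normSq_ofReal_sub_pi_mul_I _
  have hzw : z = (starRingEnd ℂ) w := by
    simp [hz, hw, mul_comm]
  have hnorm : ‖z‖ = ‖w‖ := by rw [hzw, Complex.norm_conj]
  have hn0 : 0 < ‖w‖ := norm_pos_iff.2 hw0
  have hwz : w⁻¹ = (‖w‖⁻¹ : ℝ) * Complex.exp (θ * Complex.I) := by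
    have h1 : (‖w‖ : ℂ) * Complex.exp (θ * Complex.I) = z := by
      rw [← hnorm]; exact Complex.norm_mul_exp_arg_mul_I z
    have h2 : w * z = (‖w‖ : ℂ) ^ 2 := by
      rw [hzw, Complex.mul_conj, Complex.normSq_eq_norm_sq]; push_cast; rfl
    have h3 : (‖w‖ : ℂ) ≠ 0 := by exact_mod_cast hn0.ne'
    have h4 : Complex.exp (θ * Complex.I) = z / ‖w‖ := by rw [← h1]; field_simp
    refine inv_eq_of_mul_eq_one_right ?_
    rw [h4, Complex.ofReal_inv]
    field_simp
    exact h2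
  have hpow : (Real.log r ^ 2 + Real.pi ^ 2) ^ (((k : ℝ) + 1) / 2) = ‖w‖ ^ (k + 1) := by
    rw [← hns, ← Real.rpow_natCast, ← Real.rpow_mul hn0.le, ← Real.rpow_natCast]
    congr 1
    push_cast
    ring
  have hexp : Complex.exp (-(α : ℂ) * w) =
      ((r ^ (-α) : ℝ) : ℂ) * Complex.exp ((α * Real.pi : ℝ) * Complex.I) := by
    rw [Real.rpow_def_of_pos hr, Complex.ofReal_exp, ← Complex.exp_add]
    congr 1
    rw [hw]
    push_cast
    ring
  have hker : ramanujanKernel k α r =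
      r ^ (-α) * (‖w‖⁻¹) ^ (k + 1) * Real.sin (α * Real.pi + ((k : ℝ) + 1) * θ) := by
    have : Complex.exp (-(α : ℂ) * w) / w ^ (k + 1) =
        ((r ^ (-α) * (‖w‖⁻¹) ^ (k + 1) : ℝ) : ℂ) *
          Complex.exp ((α * Real.pi + ((k : ℝ) + 1) * θ : ℝ) * Complex.I) := by
      rw [div_eq_mul_inv, ← inv_pow, hwz, mul_pow, ← Complex.exp_nat_mul, hexp]
      rw [show ((α * Real.pi + ((k : ℝ) + 1) * θ : ℝ) : ℂ) * Complex.I =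
        (α * Real.pi : ℝ) * Complex.I + ((k + 1 : ℕ) : ℂ) * (θ * Complex.I) by push_cast; ring,
        Complex.exp_add]
      push_cast
      ring
    rw [ramanujanKernel, this, Complex.im_ofReal_mul, Complex.exp_ofReal_mul_I_im]
  have hpn := (pow_pos hn0 (k + 1)).ne'
  rw [ramanujanIntegrand, hker, hpow, inv_pow, Real.rpow_neg hr.le, Real.rpow_add_one hr.ne']
  have := (Real.rpow_pos_of_pos hr α).ne'
  field_simp
  rfl

theorem hasDerivAt_ramanujanKernel (k : ℕ) (α : ℝ) {r : ℝ} (hr : 0 < r) :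
    HasDerivAt (ramanujanKernel k α)
      ((-α * ramanujanKernel k α r - (k + 1) * ramanujanKernel (k + 1) α r) / r) r := by
  set w : ℂ := (Real.log r : ℂ) - Real.pi * Complex.I with hw
  have hw0 : w ≠ 0 := ofReal_sub_pi_mul_I_ne_zero _
  have h1 : HasDerivAt (fun r : ℝ => (Real.log r : ℂ) - Real.pi * Complex.I) ((r⁻¹ : ℝ) : ℂ) r :=
    (Real.hasDerivAt_log hr.ne').ofReal_comp.sub_const _
  have h2 := (h1.const_mul (-(α : ℂ))).cexp.div (h1.pow (k + 1)) (pow_ne_zero _ hw0)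
  have h3 := Complex.imCLM.hasFDerivAt.comp_hasDerivAt r h2
  refine (h3.congr_deriv ?_)
  have e : ((Complex.exp (-(α : ℂ) * w) * (-α * (r⁻¹ : ℝ)) * w ^ (k + 1) -
      Complex.exp (-(α : ℂ) * w) * ((k + 1 : ℕ) * w ^ (k + 1 - 1) * (r⁻¹ : ℝ))) /
        (w ^ (k + 1)) ^ 2) =
      ((r⁻¹ : ℝ) : ℂ) * (((-α : ℝ) : ℂ) * (Complex.exp (-(α : ℂ) * w) / w ^ (k + 1)) -
        ((k + 1 : ℝ) : ℂ) * (Complex.exp (-(α : ℂ) * w) / w ^ (k + 1 + 1))) := by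
    rw [add_tsub_cancel_right]
    push_cast
    field_simp
    ring
  refine (congrArg Complex.im e).trans ?_
  rw [Complex.im_ofReal_mul, Complex.sub_im, Complex.im_ofReal_mul, Complex.im_ofReal_mul]
  simp only [ramanujanKernel, ← hw]
  field_simp

theorem continuousOn_ramanujanKernel (k : ℕ) (α : ℝ) :
    ContinuousOn (ramanujanKernel k α) (Ioi 0) := fun _ hr =>
  (hasDerivAt_ramanujanKernel k α hr).continuousAt.continuousWithinAt

theorem abs_ramanujanKernel_le_norm (k : ℕ) (α : ℝ) {r : ℝ} (hr : 0 < r) :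
    |ramanujanKernel k α r| ≤
      r ^ (-α) / ‖(Real.log r : ℂ) - Real.pi * Complex.I‖ ^ (k + 1) := by
  refine (Complex.abs_im_le_norm _).trans ?_
  rw [norm_div, norm_pow, norm_exp_neg_mul_log_sub_pi_mul_I α hr]

theorem abs_ramanujanKernel_le (k : ℕ) (α : ℝ) {r : ℝ} (hr : 0 < r) :
    |ramanujanKernel k α r| ≤ r ^ (-α) / Real.pi ^ (k + 1) := by
  refine (abs_ramanujanKernel_le_norm k α hr).trans ?_
  have := pi_le_norm_ofReal_sub_pi_mul_I (Real.log r)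
  have := Real.pi_pos
  gcongr

/-- The imaginary part of a power retains a factor Im v. This matters at α = 0, k = 0, where
bounding the kernel by 1/|w| leaves 1/(r |ln r|), not integrable at 0. -/
theorem Complex.abs_im_pow_succ_le (v : ℂ) (k : ℕ) :
    |(v ^ (k + 1)).im| ≤ (k + 1) * |v.im| * ‖v‖ ^ k := by
  induction k with
  | zero => simp
  | succ k ih =>
    rw [pow_succ v (k + 1), Complex.mul_im]
    have h1 : |(v ^ (k + 1)).re * v.im| ≤ ‖v‖ ^ (k + 1) * |v.im| := by
      rw [abs_mul, ← norm_pow]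
      exact mul_le_mul_of_nonneg_right (Complex.abs_re_le_norm _) (abs_nonneg _)
    have h2 : |(v ^ (k + 1)).im * v.re| ≤ (k + 1) * |v.im| * ‖v‖ ^ k * ‖v‖ := by
      rw [abs_mul]
      exact mul_le_mul ih (Complex.abs_re_le_norm _) (abs_nonneg _) (by positivity)
    refine (abs_add_le _ _).trans ((add_le_add h1 h2).trans (le_of_eq ?_))
    push_cast
    ring

theorem abs_ramanujanKernel_zero_le (k : ℕ) (r : ℝ) :
    |ramanujanKernel k 0 r| ≤
      (k + 1) * Real.pi * Real.pi⁻¹ ^ k * (1 / (Real.log r ^ 2 + Real.pi ^ 2)) := by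
  have h := Complex.abs_im_pow_succ_le ((Real.log r : ℂ) - Real.pi * Complex.I)⁻¹ k
  have e : ramanujanKernel k 0 r = ((((Real.log r : ℂ) - Real.pi * Complex.I)⁻¹) ^ (k + 1)).im := by
    simp [ramanujanKernel]
  rw [e]
  refine h.trans ?_
  have hpos : 0 < Real.pi / (Real.log r ^ 2 + Real.pi ^ 2) := by positivity
  rw [im_inv_ofReal_sub_pi_mul_I, abs_of_pos hpos, norm_inv]
  have := inv_anti₀ Real.pi_pos (pi_le_norm_ofReal_sub_pi_mul_I (Real.log r))
  calc _ ≤ (k + 1) * (Real.pi / (Real.log r ^ 2 + Real.pi ^ 2)) * Real.pi⁻¹ ^ k := by gcongr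
    _ = _ := by ring

theorem ramanujanKernel_zero_zero (r : ℝ) :
    ramanujanKernel 0 0 r = Real.pi / (Real.log r ^ 2 + Real.pi ^ 2) := by
  rw [← im_inv_ofReal_sub_pi_mul_I]
  simp [ramanujanKernel]

theorem ramanujanKernel_zero_neg_one {r : ℝ} (hr : 0 < r) :
    ramanujanKernel 0 (-1) r = -r * (Real.pi / (Real.log r ^ 2 + Real.pi ^ 2)) := by
  rw [← im_inv_ofReal_sub_pi_mul_I, ramanujanKernel, Complex.ofReal_neg, Complex.ofReal_one,
    neg_neg, one_mul, zero_add, pow_one, Complex.exp_sub, Complex.exp_pi_mul_I,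
    ← Complex.ofReal_exp, Real.exp_log hr, ← Complex.im_ofReal_mul]
  congr 1
  push_cast
  ring

/-- The primitive arctan(ln r / π)/π climbs from -1/2 to 1/2. -/
theorem integrableOn_and_integral_one_div_mul_log_sq_add_pi_sq :
    IntegrableOn (fun r : ℝ => 1 / (r * (Real.log r ^ 2 + Real.pi ^ 2))) (Ioi 0) ∧
      ∫ r in Ioi (0 : ℝ), 1 / (r * (Real.log r ^ 2 + Real.pi ^ 2)) = 1 := by
  have hpi := Real.pi_pos
  -- `Real.log 0 = 0` would give the primitive the value 0 at 0; it is replaced by the limit -1/2 to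
  -- obtain right continuity there.
  set g : ℝ → ℝ := Function.update (fun r => Real.arctan (Real.log r / Real.pi) / Real.pi) 0 (-1 / 2)
    with hg
  have hgr : ∀ r, r ≠ 0 → g r = Real.arctan (Real.log r / Real.pi) / Real.pi := fun r hr =>
    Function.update_of_ne hr _ _
  have h0 : g 0 = -1 / 2 := Function.update_self _ _ _
  have hcont : ContinuousWithinAt g (Ici 0) 0 := by
    rw [← continuousWithinAt_Ioi_iff_Ici, ContinuousWithinAt, h0]
    have h1 : Tendsto (fun r => Real.log r / Real.pi) (𝓝[>] 0) atBot :=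
      Real.tendsto_log_nhdsGT_zero.atBot_div_const hpi
    have h2 := ((Real.tendsto_arctan_atBot.mono_right nhdsWithin_le_nhds).comp h1).div_const Real.pi
    rw [show -(Real.pi / 2) / Real.pi = -1 / 2 by field_simp] at h2
    refine h2.congr' ?_
    filter_upwards [self_mem_nhdsWithin] with r hr
    exact (hgr r (ne_of_gt hr)).symm
  have hderiv : ∀ r ∈ Ioi (0 : ℝ),
      HasDerivAt g (1 / (r * (Real.log r ^ 2 + Real.pi ^ 2))) r := by
    intro r hr
    have hr' : 0 < r := hr
    have h1 := ((Real.hasDerivAt_log hr'.ne').div_const Real.pi).arctan.div_const Real.pi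
    have h2 : g =ᶠ[𝓝 r] fun r => Real.arctan (Real.log r / Real.pi) / Real.pi := by
      filter_upwards [lt_mem_nhds hr'] with s hs using hgr s (ne_of_gt hs)
    refine (h1.congr_of_eventuallyEq h2).congr_deriv ?_
    have : Real.log r ^ 2 + Real.pi ^ 2 ≠ 0 := by positivity
    have : Real.pi ^ 2 + Real.log r ^ 2 ≠ 0 := by positivity
    field_simp
    ring
  have hpos : ∀ r ∈ Ioi (0 : ℝ), 0 ≤ 1 / (r * (Real.log r ^ 2 + Real.pi ^ 2)) := by
    intro r hr
    have hr' : 0 < r := hr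
    positivity
  have htop : Tendsto g atTop (𝓝 (1 / 2)) := by
    have h1 : Tendsto (fun r => Real.log r / Real.pi) atTop atTop :=
      Real.tendsto_log_atTop.atTop_div_const hpi
    have h2 := ((Real.tendsto_arctan_atTop.mono_right nhdsWithin_le_nhds).comp h1).div_const Real.pi
    rw [show (Real.pi / 2) / Real.pi = 1 / 2 by field_simp] at h2
    refine h2.congr' ?_
    filter_upwards [eventually_gt_atTop 0] with r hr
    exact (hgr r (ne_of_gt hr)).symm
  refine ⟨integrableOn_Ioi_deriv_of_nonneg hcont hderiv hpos htop, ?_⟩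
  rw [integral_Ioi_of_hasDerivAt_of_nonneg hcont hderiv hpos htop, h0]
  norm_num

/-! ### Convergence of N_k and its recursion in k. -/

theorem integrableOn_exp_neg_mul_mul_rpow {a t : ℝ} (ha : -1 < a) (ht : 0 < t) :
    IntegrableOn (fun r : ℝ => Real.exp (-(r * t)) * r ^ a) (Ioi 0) := by
  have h := integrableOn_rpow_mul_exp_neg_mul_rpow (p := 1) (s := a) (b := t) ha one_pos ht
  refine h.congr_fun (fun r _ => ?_) measurableSet_Ioi
  simp only [Real.rpow_one]
  ring_nf

theorem continuousOn_exp_mul_ramanujanKernel (k : ℕ) (t α : ℝ) :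
    ContinuousOn (fun r => Real.exp (-(r * t)) / r * ramanujanKernel k α r) (Ioi 0) := by
  refine ContinuousOn.mul (ContinuousOn.div (by fun_prop) continuousOn_id fun r hr => ne_of_gt hr)
    (continuousOn_ramanujanKernel k α)

theorem integrableOn_exp_mul_ramanujanKernel (k : ℕ) {t α : ℝ} (ht : 0 < t) (hα : α ≤ 0) :
    IntegrableOn (fun r => Real.exp (-(r * t)) / r * ramanujanKernel k α r) (Ioi 0) := by
  have hmeas := (continuousOn_exp_mul_ramanujanKernel k t α).aestronglyMeasurable (μ := volume)
    measurableSet_Ioi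
  -- For α < 0 the power r^{-α-1} is integrable at 0; for α = 0 the decay must come from the
  -- logarithm.
  rcases hα.lt_or_eq with h | rfl
  · refine Integrable.mono' ((integrableOn_exp_neg_mul_mul_rpow (a := -α - 1) (by linarith)
      ht).const_mul (1 / Real.pi ^ (k + 1))) hmeas ?_
    filter_upwards [ae_restrict_mem measurableSet_Ioi] with r hr
    have hr' : 0 < r := hr
    rw [norm_mul, Real.norm_of_nonneg (by positivity), Real.norm_eq_abs]
    calc _ ≤ Real.exp (-(r * t)) / r * (r ^ (-α) / Real.pi ^ (k + 1)) := by
          gcongr; exact abs_ramanujanKernel_le k α hr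
      _ = _ := by rw [Real.rpow_sub_one hr'.ne']; ring
  · refine Integrable.mono' (integrableOn_and_integral_one_div_mul_log_sq_add_pi_sq.1.const_mul
      ((k + 1) * Real.pi * Real.pi⁻¹ ^ k)) hmeas ?_
    filter_upwards [ae_restrict_mem measurableSet_Ioi] with r hr
    have hr' : 0 < r := hr
    rw [norm_mul, Real.norm_of_nonneg (by positivity), Real.norm_eq_abs]
    have h1 : Real.exp (-(r * t)) ≤ 1 := Real.exp_le_one_iff.2 (by nlinarith)
    calc _ ≤ 1 / r * ((k + 1) * Real.pi * Real.pi⁻¹ ^ k *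
          (1 / (Real.log r ^ 2 + Real.pi ^ 2))) := by
          gcongr; exact abs_ramanujanKernel_zero_le k r
      _ = _ := by field_simp

theorem integrableOn_ramanujanIntegrand (k : ℕ) {t α : ℝ} (ht : 0 < t) (hα : α ≤ 0) :
    IntegrableOn (ramanujanIntegrand k t α) (Ioi 0) :=
  (integrableOn_exp_mul_ramanujanKernel k ht hα).congr_fun
    (fun _ hr => (ramanujanIntegrand_eq k t α hr).symm) measurableSet_Ioi

theorem generalizedRamanujanN_eq (k : ℕ) (t α : ℝ) :
    generalizedRamanujanN k t α =
      1 / Real.pi * ∫ r in Ioi (0 : ℝ), Real.exp (-(r * t)) / r * ramanujanKernel k α r := by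
  rw [generalizedRamanujanN]
  congr 1
  exact setIntegral_congr_fun measurableSet_Ioi fun r hr => ramanujanIntegrand_eq k t α hr

theorem integrableOn_exp_mul_ramanujanKernel' (k : ℕ) {t α : ℝ} (ht : 0 < t) (hα : α ≤ 0) :
    IntegrableOn (fun r => Real.exp (-(r * t)) * ramanujanKernel k α r) (Ioi 0) := by
  refine Integrable.mono' ((integrableOn_exp_neg_mul_mul_rpow (a := -α) (by linarith)
    ht).mul_const (1 / Real.pi ^ (k + 1)))
    (((by fun_prop : Continuous fun r => Real.exp (-(r * t))).continuousOn.mul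
      (continuousOn_ramanujanKernel k α)).aestronglyMeasurable measurableSet_Ioi) ?_
  filter_upwards [ae_restrict_mem measurableSet_Ioi] with r hr
  rw [norm_mul, Real.norm_of_nonneg (Real.exp_pos _).le, Real.norm_eq_abs]
  calc _ ≤ Real.exp (-(r * t)) * (r ^ (-α) / Real.pi ^ (k + 1)) := by
        gcongr; exact abs_ramanujanKernel_le k α hr
    _ = _ := by ring

theorem hasDerivAt_integral_exp_mul_ramanujanKernel (k : ℕ) {t α : ℝ} (ht : 0 < t) (hα : α ≤ 0) :
    HasDerivAt (fun t => ∫ r in Ioi (0 : ℝ), Real.exp (-(r * t)) / r * ramanujanKernel k α r)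
      (∫ r in Ioi (0 : ℝ), -(Real.exp (-(r * t)) * ramanujanKernel k α r)) t := by
  have ha : 0 < t / 2 := by linarith
  refine (hasDerivAt_integral_of_dominated_loc_of_deriv_le (μ := volume.restrict (Ioi 0))
    (F := fun t r => Real.exp (-(r * t)) / r * ramanujanKernel k α r)
    (F' := fun t r => -(Real.exp (-(r * t)) * ramanujanKernel k α r))
    (bound := fun r => ‖Real.exp (-(r * (t / 2))) * ramanujanKernel k α r‖)
    (x₀ := t) (s := Ioi (t / 2)) (Ioi_mem_nhds (by linarith)) (.of_forall fun s => ?_)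
    (integrableOn_exp_mul_ramanujanKernel k ht hα)
    (integrableOn_exp_mul_ramanujanKernel' k ht hα).neg.aestronglyMeasurable ?_
    (integrableOn_exp_mul_ramanujanKernel' k ha hα).norm ?_).2
  · exact (continuousOn_exp_mul_ramanujanKernel k s α).aestronglyMeasurable measurableSet_Ioi
  · filter_upwards [ae_restrict_mem measurableSet_Ioi] with r hr s hs
    have hr' : 0 < r := hr
    have hs' : t / 2 < s := hs
    rw [norm_neg, norm_mul, norm_mul, Real.norm_of_nonneg (Real.exp_pos _).le,
      Real.norm_of_nonneg (Real.exp_pos _).le]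
    gcongr
  · filter_upwards [ae_restrict_mem measurableSet_Ioi] with r hr s _
    have hr' : r ≠ 0 := ne_of_gt hr
    have h1 : HasDerivAt (fun s : ℝ => -(r * s)) (-r) s := by
      simpa using ((hasDerivAt_id s).const_mul r).fun_neg
    refine ((h1.exp.div_const r).mul_const (ramanujanKernel k α r)).congr_deriv ?_
    field_simp

/-- At α = 0 the power of r gives no decay, so one factor of |w|^{k+1} is bounded below by |ln r|
and the others by π. -/
theorem tendsto_exp_mul_ramanujanKernel_nhdsGT_zero (k : ℕ) {t α : ℝ} (ht : 0 < t) (hα : α ≤ 0) :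
    Tendsto (fun r => Real.exp (-(r * t)) * ramanujanKernel k α r) (𝓝[>] 0) (𝓝 0) := by
  have hlim : Tendsto (fun r : ℝ => (Real.pi ^ k)⁻¹ * |Real.log r|⁻¹) (𝓝[>] 0) (𝓝 0) := by
    have := (tendsto_inv_atTop_zero.comp
      (tendsto_abs_atBot_atTop.comp Real.tendsto_log_nhdsGT_zero)).const_mul (Real.pi ^ k)⁻¹
    rwa [mul_zero] at this
  refine squeeze_zero_norm' ?_ hlim
  filter_upwards [Ioo_mem_nhdsGT (zero_lt_one' ℝ)] with r hr
  have hlog : 0 < |Real.log r| := abs_pos.2 (Real.log_neg hr.1 hr.2).ne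
  have h1 := pi_le_norm_ofReal_sub_pi_mul_I (Real.log r)
  have h2 := abs_le_norm_ofReal_sub_pi_mul_I (Real.log r)
  have h3 : r ^ (-α) ≤ 1 := Real.rpow_le_one hr.1.le hr.2.le (by linarith)
  have h4 : Real.exp (-(r * t)) ≤ 1 := Real.exp_le_one_iff.2 (by nlinarith [hr.1])
  have hpi := Real.pi_pos
  rw [norm_mul, Real.norm_of_nonneg (Real.exp_pos _).le, Real.norm_eq_abs]
  calc _ ≤ 1 * (1 / (Real.pi ^ k * |Real.log r|)) := by
        refine mul_le_mul h4 ((abs_ramanujanKernel_le_norm k α hr.1).trans ?_) (abs_nonneg _)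
          zero_le_one
        rw [pow_succ]
        gcongr
    _ = _ := by rw [one_mul, one_div, mul_inv]

theorem tendsto_exp_mul_ramanujanKernel_atTop (k : ℕ) {t : ℝ} (α : ℝ) (ht : 0 < t) :
    Tendsto (fun r => Real.exp (-(r * t)) * ramanujanKernel k α r) atTop (𝓝 0) := by
  have hlim : Tendsto (fun r : ℝ => r ^ (-α) * Real.exp (-t * r) * (1 / Real.pi ^ (k + 1)))
      atTop (𝓝 0) := by
    simpa using (tendsto_rpow_mul_exp_neg_mul_atTop_nhds_zero (-α) t ht).mul_const
      (1 / Real.pi ^ (k + 1))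
  refine squeeze_zero_norm' ?_ hlim
  filter_upwards [eventually_gt_atTop 0] with r hr
  rw [norm_mul, Real.norm_of_nonneg (Real.exp_pos _).le, Real.norm_eq_abs]
  calc _ ≤ Real.exp (-(r * t)) * (r ^ (-α) / Real.pi ^ (k + 1)) := by
        gcongr; exact abs_ramanujanKernel_le k α hr
    _ = _ := by rw [show -t * r = -(r * t) by ring]; ring

/-- Differentiation in t cancels the 1/r; integrating by parts moves the factor t onto the kernel,
whose r-derivative restores 1/r and yields the kernels of orders k and k+1. -/
theorem hasDerivAt_generalizedRamanujanN (k : ℕ) {t α : ℝ} (ht : 0 < t) (hα : α ≤ 0) :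
    HasDerivAt (fun t => generalizedRamanujanN k t α)
      (t⁻¹ * (α * generalizedRamanujanN k t α +
        (k + 1) * generalizedRamanujanN (k + 1) t α)) t := by
  have i0 := integrableOn_exp_mul_ramanujanKernel k ht hα
  have i1 := integrableOn_exp_mul_ramanujanKernel (k + 1) ht hα
  have i2 := integrableOn_exp_mul_ramanujanKernel' k ht hα
  have hu : ∀ r ∈ Ioi (0 : ℝ), HasDerivAt (fun r : ℝ => Real.exp (-(r * t)))
      (-t * Real.exp (-(r * t))) r := by
    intro r _
    have h1 : HasDerivAt (fun r : ℝ => -(r * t)) (-t) r := by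
      simpa using ((hasDerivAt_id r).mul_const t).fun_neg
    exact h1.exp.congr_deriv (by ring)
  have e : ∀ r : ℝ, Real.exp (-(r * t)) *
      ((-α * ramanujanKernel k α r - (k + 1) * ramanujanKernel (k + 1) α r) / r) =
      -α * (Real.exp (-(r * t)) / r * ramanujanKernel k α r) -
        (k + 1) * (Real.exp (-(r * t)) / r * ramanujanKernel (k + 1) α r) := fun r => by ring
  have hparts := integral_Ioi_mul_deriv_eq_deriv_mul hu
    (fun r hr => hasDerivAt_ramanujanKernel k α hr)
    (((i0.const_mul (-α)).sub (i1.const_mul ((k : ℝ) + 1))).congr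
      (.of_forall fun r => (e r).symm))
    ((i2.const_mul (-t)).congr (.of_forall fun r => (mul_assoc _ _ _).symm))
    (tendsto_exp_mul_ramanujanKernel_nhdsGT_zero k ht hα)
    (tendsto_exp_mul_ramanujanKernel_atTop k α ht)
  simp only [e, mul_assoc (-t)] at hparts
  rw [integral_sub (i0.const_mul (-α)) (i1.const_mul ((k : ℝ) + 1)), integral_const_mul,
    integral_const_mul, integral_const_mul] at hparts
  have hd := (hasDerivAt_integral_exp_mul_ramanujanKernel k ht hα).const_mul (1 / Real.pi)
  simp only [generalizedRamanujanN_eq]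
  refine hd.congr_deriv ?_
  rw [integral_neg]
  generalize (∫ r in Ioi (0 : ℝ), Real.exp (-(r * t)) / r * ramanujanKernel k α r) = A at *
  generalize (∫ r in Ioi (0 : ℝ), Real.exp (-(r * t)) / r * ramanujanKernel (k + 1) α r) = B at *
  generalize (∫ r in Ioi (0 : ℝ), Real.exp (-(r * t)) * ramanujanKernel k α r) = D at *
  have hpi := Real.pi_ne_zero
  field_simp
  linear_combination hparts

/-! ### The case k = 0: independence of α. -/

theorem volterraIntegrand_zero (t α u : ℝ) :
    volterraIntegrand t 0 α u = t ^ (u + α) / Real.Gamma (u + α + 1) := by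
  simp [volterraIntegrand]

theorem integrableOn_rpow_div_Gamma {t α : ℝ} (ht : 0 < t) (hα : -1 ≤ α) :
    IntegrableOn (fun v => t ^ v / Real.Gamma (v + 1)) (Ioi α) := by
  have h := integrableOn_volterraIntegrand ht (β := 0) (by norm_num) hα
  have e := (measurePreserving_add_right volume α).integrableOn_comp_preimage
    (measurableEmbedding_addRight α) (f := fun v => t ^ v / Real.Gamma (v + 1)) (s := Ioi α)
  refine e.1 ?_
  have hs : (fun x => x + α) ⁻¹' Ioi α = Ioi 0 := by ext; simp
  rw [hs]
  exact h.congr_fun (fun u _ => volterraIntegrand_zero t α u) measurableSet_Ioi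

/-- After the shift v = u + α, the parameter α survives only as the lower endpoint. -/
theorem volterraMu_zero_eq (t α : ℝ) :
    volterraMu t 0 α = ∫ v in Ioi α, t ^ v / Real.Gamma (v + 1) := by
  have e := (measurePreserving_add_right volume α).setIntegral_preimage_emb
    (measurableEmbedding_addRight α) (fun v => t ^ v / Real.Gamma (v + 1)) (Ioi α)
  have hs : (fun x => x + α) ⁻¹' Ioi α = Ioi 0 := by ext; simp
  rw [← e, hs, volterraMu]
  simp only [volterraIntegrand_zero]
  simp

theorem volterraMu_zero_sub {t α : ℝ} (ht : 0 < t) (hα : -1 ≤ α) (hα0 : α ≤ 0) :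
    volterraMu t 0 α =
      (∫ v in Ioo α 0, t ^ v / Real.Gamma (v + 1)) + volterraMu t 0 0 := by
  have hi := integrableOn_rpow_div_Gamma ht hα
  rw [volterraMu_zero_eq, volterraMu_zero_eq, ← integral_Ioc_eq_integral_Ioo,
    ← Ioc_union_Ioi_eq_Ioi hα0, setIntegral_union (Ioc_disjoint_Ioi le_rfl) measurableSet_Ioi
      (hi.mono_set Ioc_subset_Ioi_self) (hi.mono_set (Ioi_subset_Ioi hα0))]

theorem integrableOn_reflection {t v : ℝ} (ht : 0 < t) (hv : v < 0) :
    IntegrableOn (fun r => -(1 / Real.pi * Real.sin (Real.pi * v)) *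
      (Real.exp (-(r * t)) * r ^ (-v - 1))) (Ioi 0) :=
  (integrableOn_exp_neg_mul_mul_rpow (by linarith) ht).const_mul _

/-- The r-integral is t^v Γ(-v), and reflection gives Γ(-v) Γ(v+1) = -π / sin(πv) for -1 < v < 0. -/
theorem rpow_div_Gamma_eq_integral {t v : ℝ} (ht : 0 < t) (hv1 : -1 < v) (hv : v < 0) :
    ∫ r in Ioi (0 : ℝ), -(1 / Real.pi * Real.sin (Real.pi * v)) *
      (Real.exp (-(r * t)) * r ^ (-v - 1)) = t ^ v / Real.Gamma (v + 1) := by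
  have h := Real.integral_rpow_mul_exp_neg_mul_Ioi (a := -v) (by linarith) ht
  have h' : ∫ r in Ioi (0 : ℝ), Real.exp (-(r * t)) * r ^ (-v - 1) = t ^ v * Real.Gamma (-v) := by
    rw [one_div, Real.inv_rpow ht.le, Real.rpow_neg ht.le, inv_inv] at h
    rw [← h]
    congr 1
    ext r
    rw [mul_comm t r, mul_comm]
  have hr := Real.Gamma_mul_Gamma_one_sub (-v)
  have hG := (Real.Gamma_pos_of_pos (show 0 < v + 1 by linarith)).ne'
  have hs : Real.sin (Real.pi * v) ≠ 0 := by
    apply ne_of_lt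
    apply Real.sin_neg_of_neg_of_neg_pi_lt <;> nlinarith [Real.pi_pos]
  rw [show 1 - -v = v + 1 by ring, mul_neg, Real.sin_neg] at hr
  rw [integral_const_mul, h', (eq_div_iff hG).2 hr]
  have := Real.pi_ne_zero
  field_simp

/-- Differentiating e^{-vw}/w in v cancels the denominator; what remains is the sine factor of the
reflection formula. -/
theorem hasDerivAt_ramanujanKernel_zero_exponent {r : ℝ} (hr : 0 < r) (v : ℝ) :
    HasDerivAt (fun v => ramanujanKernel 0 v r) (-(Real.sin (Real.pi * v) * r ^ (-v))) v := by
  set w : ℂ := (Real.log r : ℂ) - Real.pi * Complex.I with hw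
  have hw0 : w ≠ 0 := ofReal_sub_pi_mul_I_ne_zero _
  have h1 : HasDerivAt (fun v : ℝ => -(v : ℂ) * w) (-w) v := by
    simpa using (Complex.ofRealCLM.hasDerivAt (x := v)).fun_neg.mul_const w
  have h2 := h1.cexp.div_const (w ^ (0 + 1))
  have h3 := Complex.imCLM.hasFDerivAt.comp_hasDerivAt v h2
  refine h3.congr_deriv ?_
  have e : Complex.exp (-(v : ℂ) * w) * -w / w ^ (0 + 1) =
      ((-(r ^ (-v)) : ℝ) : ℂ) * Complex.exp ((Real.pi * v : ℝ) * Complex.I) := by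
    rw [Real.rpow_def_of_pos hr, Complex.ofReal_neg, Complex.ofReal_exp, neg_mul (Complex.exp _),
      ← Complex.exp_add, zero_add, pow_one, mul_neg, neg_div, mul_div_cancel_right₀ _ hw0]
    congr 2
    rw [hw]
    push_cast
    ring
  refine (congrArg Complex.im e).trans ?_
  rw [Complex.im_ofReal_mul, Complex.exp_ofReal_mul_I_im]
  ring

theorem integral_reflection_exponent {r a : ℝ} (t : ℝ) (hr : 0 < r) (ha : a ≤ 0) :
    ∫ v in Ioo a 0, -(1 / Real.pi * Real.sin (Real.pi * v)) *
      (Real.exp (-(r * t)) * r ^ (-v - 1)) =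
    1 / Real.pi * (Real.exp (-(r * t)) / r * ramanujanKernel 0 0 r -
      Real.exp (-(r * t)) / r * ramanujanKernel 0 a r) := by
  have hc : Continuous fun v : ℝ => -(Real.sin (Real.pi * v) * r ^ (-v)) :=
    ((Real.continuous_sin.comp (continuous_const.mul continuous_id)).mul
      (Continuous.rpow continuous_const continuous_neg fun _ => Or.inl hr.ne')).neg
  have h := intervalIntegral.integral_eq_sub_of_hasDerivAt (a := a) (b := 0)
    (fun v _ => hasDerivAt_ramanujanKernel_zero_exponent hr v) (hc.intervalIntegrable _ _)
  rw [intervalIntegral.integral_of_le ha, integral_Ioc_eq_integral_Ioo] at h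
  rw [← mul_sub, ← h, ← integral_const_mul, ← integral_const_mul]
  refine integral_congr_ae (.of_forall fun v => ?_)
  simp only [Real.rpow_sub_one hr.ne']
  ring

/-- Fubini in (v, r). The integrand is nonnegative because sin(πv) ≤ 0 on the strip, so joint
integrability reduces to that of t^v/Γ(v+1). -/
theorem integral_rpow_div_Gamma {t a : ℝ} (ht : 0 < t) (ha : -1 ≤ a) (ha0 : a ≤ 0) :
    ∫ v in Ioo a 0, t ^ v / Real.Gamma (v + 1) =
      generalizedRamanujanN 0 t 0 - generalizedRamanujanN 0 t a := by
  set K : ℝ → ℝ → ℝ := fun v r => -(1 / Real.pi * Real.sin (Real.pi * v)) *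
    (Real.exp (-(r * t)) * r ^ (-v - 1)) with hK
  have hmeas : Measurable (Function.uncurry K) := by
    simp only [hK, Function.uncurry_def]
    fun_prop
  have hnonneg : ∀ v ∈ Ioo a 0, ∀ r ∈ Ioi (0 : ℝ), 0 ≤ K v r := by
    intro v hv r hr
    have hr' : 0 < r := hr
    have hs : Real.sin (Real.pi * v) ≤ 0 := by
      apply Real.sin_nonpos_of_nonpos_of_neg_pi_le <;>
        nlinarith [Real.pi_pos, hv.1, hv.2]
    have hp : 0 ≤ -(1 / Real.pi * Real.sin (Real.pi * v)) := by
      rw [neg_nonneg]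
      exact mul_nonpos_of_nonneg_of_nonpos (by positivity) hs
    exact mul_nonneg hp (by positivity)
  have hint : Integrable (Function.uncurry K)
      ((volume.restrict (Ioo a 0)).prod (volume.restrict (Ioi 0))) := by
    rw [integrable_prod_iff hmeas.aestronglyMeasurable]
    constructor
    · filter_upwards [ae_restrict_mem measurableSet_Ioo] with v hv
      exact integrableOn_reflection ht hv.2
    · refine IntegrableOn.congr_fun ((integrableOn_rpow_div_Gamma ht ha).mono_set
        Ioo_subset_Ioi_self) (fun v hv => ?_) measurableSet_Ioo
      rw [← rpow_div_Gamma_eq_integral ht (ha.trans_lt hv.1) hv.2]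
      exact setIntegral_congr_fun measurableSet_Ioi fun r hr =>
        (Real.norm_of_nonneg (hnonneg v hv r hr)).symm
  have i0 := integrableOn_exp_mul_ramanujanKernel 0 ht le_rfl
  have ia := integrableOn_exp_mul_ramanujanKernel 0 ht ha0
  calc ∫ v in Ioo a 0, t ^ v / Real.Gamma (v + 1)
      = ∫ v in Ioo a 0, ∫ r in Ioi (0 : ℝ), K v r :=
        setIntegral_congr_fun measurableSet_Ioo fun v hv =>
          (rpow_div_Gamma_eq_integral ht (ha.trans_lt hv.1) hv.2).symm
    _ = ∫ r in Ioi (0 : ℝ), ∫ v in Ioo a 0, K v r := integral_integral_swap hint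
    _ = ∫ r in Ioi (0 : ℝ), 1 / Real.pi * (Real.exp (-(r * t)) / r * ramanujanKernel 0 0 r -
          Real.exp (-(r * t)) / r * ramanujanKernel 0 a r) :=
        setIntegral_congr_fun measurableSet_Ioi fun r hr =>
          integral_reflection_exponent t hr ha0
    _ = _ := by
        rw [integral_const_mul, integral_sub i0 ia, generalizedRamanujanN_eq,
          generalizedRamanujanN_eq, mul_sub]

theorem volterraMu_zero_add_generalizedRamanujanN {t α : ℝ} (ht : 0 < t) (hα : -1 ≤ α)
    (hα0 : α ≤ 0) :
    volterraMu t 0 α + generalizedRamanujanN 0 t α =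
      volterraMu t 0 0 + generalizedRamanujanN 0 t 0 := by
  rw [volterraMu_zero_sub ht hα hα0, integral_rpow_div_Gamma ht hα hα0]
  ring

/-! ### The case k = 0, α = 0: the equation f' = f. -/

theorem volterraMu_one_zero (t : ℝ) (ht : 0 < t) : volterraMu t 1 0 = t * volterraMu t 0 (-1) := by
  have e : ∫ u in Ioi (0 : ℝ), volterraIntegrand t 1 0 u =
      ∫ u in Ioi (0 : ℝ), t * volterraIntegrand t 0 (-1) u := by
    refine setIntegral_congr_fun measurableSet_Ioi fun u hu => ?_
    have hu' : 0 < u := hu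
    have hG := (Real.Gamma_pos_of_pos hu').ne'
    simp only [volterraIntegrand, add_zero, Real.rpow_one, Real.rpow_zero, mul_one,
      Real.Gamma_add_one hu'.ne', ← sub_eq_add_neg, sub_add_cancel,
      Real.rpow_sub_one ht.ne']
    field_simp
  rw [volterraMu, volterraMu, e, integral_const_mul]
  norm_num

theorem hasDerivAt_generalizedRamanujanN_zero_zero {t : ℝ} (ht : 0 < t) :
    HasDerivAt (fun t => generalizedRamanujanN 0 t 0) (generalizedRamanujanN 0 t (-1)) t := by
  have h := (hasDerivAt_integral_exp_mul_ramanujanKernel 0 ht le_rfl).const_mul (1 / Real.pi)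
  simp only [generalizedRamanujanN_eq]
  refine h.congr_deriv ?_
  congr 1
  refine setIntegral_congr_fun measurableSet_Ioi fun r hr => ?_
  have hr' : r ≠ 0 := ne_of_gt hr
  simp only [ramanujanKernel_zero_neg_one hr, ramanujanKernel_zero_zero]
  field_simp

/-- Both derivatives are the same functions at α = -1, and independence of α down to this endpoint
returns the sum to α = 0. -/
theorem hasDerivAt_volterraMu_add_generalizedRamanujanN {t : ℝ} (ht : 0 < t) :
    HasDerivAt (fun t => volterraMu t 0 0 + generalizedRamanujanN 0 t 0)
      (volterraMu t 0 0 + generalizedRamanujanN 0 t 0) t := by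
  refine ((hasDerivAt_volterraMu ht (by norm_num) (by norm_num)).add
    (hasDerivAt_generalizedRamanujanN_zero_zero ht)).congr_deriv ?_
  have h := volterraMu_zero_add_generalizedRamanujanN ht le_rfl (by norm_num)
  rw [← h, zero_add, zero_mul, add_zero, one_mul, volterraMu_one_zero t ht,
    inv_mul_cancel_left₀ ht.ne']

theorem tendsto_volterraMu_zero_zero :
    Tendsto (fun t => volterraMu t 0 0) (𝓝[>] 0) (𝓝 0) := by
  have hl : Tendsto (fun t => ∫ u in Ioi (0 : ℝ), volterraIntegrand t 0 0 u) (𝓝[>] 0)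
      (𝓝 (∫ _ in Ioi (0 : ℝ), (0 : ℝ))) := by
    refine tendsto_integral_filter_of_dominated_convergence (volterraIntegrand 1 0 0) ?_ ?_
      (integrableOn_volterraIntegrand one_pos (by norm_num) (by norm_num)) ?_
    · filter_upwards [self_mem_nhdsWithin] with t ht
      exact (continuousOn_volterraIntegrand 0 ht (by norm_num)).aestronglyMeasurable
        measurableSet_Ioi
    · filter_upwards [Ioo_mem_nhdsGT (zero_lt_one' ℝ)] with t ht
      filter_upwards [ae_restrict_mem measurableSet_Ioi] with u hu
      have hu' : 0 < u := hu
      rw [Real.norm_of_nonneg (volterraIntegrand_nonneg 0 ht.1 (by norm_num) hu)]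
      have hG := Real.Gamma_pos_of_pos (show 0 < u + 0 + 1 by linarith)
      rw [volterraIntegrand_zero, volterraIntegrand_zero]
      have := ht.1.le
      have := ht.2.le
      gcongr
    · filter_upwards [ae_restrict_mem measurableSet_Ioi] with u hu
      have hu' : 0 < u := hu
      have h1 : Tendsto (fun t : ℝ => t ^ u) (𝓝[>] 0) (𝓝 0) := by
        have := (Real.continuousAt_rpow_const 0 u (Or.inr hu'.le)).tendsto
        rw [Real.zero_rpow hu'.ne'] at this
        exact this.mono_left nhdsWithin_le_nhds
      simpa [volterraIntegrand_zero] using h1.div_const (Real.Gamma (u + 1))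
  simpa [volterraMu] using hl

theorem tendsto_generalizedRamanujanN_zero_zero :
    Tendsto (fun t => generalizedRamanujanN 0 t 0) (𝓝[>] 0) (𝓝 1) := by
  have hpi := Real.pi_pos
  have hint := integrableOn_and_integral_one_div_mul_log_sq_add_pi_sq
  have hl : Tendsto (fun t => ∫ r in Ioi (0 : ℝ), Real.exp (-(r * t)) / r * ramanujanKernel 0 0 r)
      (𝓝[>] 0) (𝓝 (∫ r in Ioi (0 : ℝ), Real.pi * (1 / (r * (Real.log r ^ 2 + Real.pi ^ 2))))) := by
    refine tendsto_integral_filter_of_dominated_convergence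
      (fun r => Real.pi * (1 / (r * (Real.log r ^ 2 + Real.pi ^ 2)))) ?_ ?_
      (hint.1.const_mul _) ?_
    · exact .of_forall fun t => (continuousOn_exp_mul_ramanujanKernel 0 t 0).aestronglyMeasurable
        measurableSet_Ioi
    · filter_upwards [self_mem_nhdsWithin] with t ht
      have ht' : 0 < t := ht
      filter_upwards [ae_restrict_mem measurableSet_Ioi] with r hr
      have hr' : 0 < r := hr
      have h1 : Real.exp (-(r * t)) ≤ 1 := Real.exp_le_one_iff.2 (by nlinarith)
      rw [ramanujanKernel_zero_zero, Real.norm_of_nonneg (by positivity)]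
      calc _ ≤ 1 / r * (Real.pi / (Real.log r ^ 2 + Real.pi ^ 2)) := by gcongr
        _ = _ := by field_simp
    · filter_upwards [ae_restrict_mem measurableSet_Ioi] with r hr
      have hr' : r ≠ 0 := ne_of_gt hr
      have hc : Continuous fun t : ℝ => Real.exp (-(r * t)) / r * ramanujanKernel 0 0 r := by
        fun_prop
      have h1 := (hc.tendsto 0).mono_left (nhdsWithin_le_nhds (s := Ioi 0))
      convert h1 using 2
      rw [ramanujanKernel_zero_zero, mul_zero, neg_zero, Real.exp_zero]
      field_simp
  rw [integral_const_mul, hint.2, mul_one] at hl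
  have h2 := hl.const_mul (1 / Real.pi)
  rw [one_div_mul_cancel hpi.ne'] at h2
  simpa only [generalizedRamanujanN_eq] using h2

theorem volterraMu_zero_zero {t : ℝ} (ht : 0 < t) :
    volterraMu t 0 0 + generalizedRamanujanN 0 t 0 = Real.exp t := by
  set f : ℝ → ℝ := fun t => volterraMu t 0 0 + generalizedRamanujanN 0 t 0 with hf
  have hd : ∀ s ∈ Ioi (0 : ℝ), HasDerivAt (fun s => Real.exp (-s) * f s) 0 s := by
    intro s hs
    refine ((hasDerivAt_neg s).exp.mul
      (hasDerivAt_volterraMu_add_generalizedRamanujanN hs)).congr_deriv ?_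
    ring
  have hconst : ∀ s ∈ Ioi (0 : ℝ), Real.exp (-s) * f s = Real.exp (-t) * f t := fun s hs =>
    isOpen_Ioi.is_const_of_deriv_eq_zero isPreconnected_Ioi
      (fun x hx => (hd x hx).differentiableAt.differentiableWithinAt)
      (fun x hx => (hd x hx).deriv) hs ht
  have hlim : Tendsto (fun s => Real.exp (-s) * f s) (𝓝[>] 0) (𝓝 1) := by
    have h1 : Tendsto (fun s : ℝ => Real.exp (-s)) (𝓝[>] 0) (𝓝 1) := by
      have hc : Continuous fun s : ℝ => Real.exp (-s) := by fun_prop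
      simpa using (hc.tendsto 0).mono_left (nhdsWithin_le_nhds (s := Ioi 0))
    simpa using h1.mul
      (tendsto_volterraMu_zero_zero.add tendsto_generalizedRamanujanN_zero_zero)
  have hlim' : Tendsto (fun s => Real.exp (-s) * f s) (𝓝[>] 0) (𝓝 (Real.exp (-t) * f t)) :=
    tendsto_const_nhds.congr' (by
      filter_upwards [self_mem_nhdsWithin] with s hs using (hconst s hs).symm)
  have h := tendsto_nhds_unique hlim' hlim
  rw [Real.exp_neg, inv_mul_eq_one₀ (Real.exp_ne_zero t)] at h
  exact h.symm

/-! ### Induction on k and the theorem. -/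

theorem volterraMu_eq (k : ℕ) {α : ℝ} (hα : -1 ≤ α) (hα0 : α ≤ 0) {t : ℝ} (ht : 0 < t) :
    volterraMu t k α =
      Real.exp t / k.factorial * (residuePoly α k).eval t - generalizedRamanujanN k t α := by
  induction k generalizing t with
  | zero =>
    have h := (volterraMu_zero_add_generalizedRamanujanN ht hα hα0).trans (volterraMu_zero_zero ht)
    simp only [Nat.cast_zero, residuePoly, Nat.factorial_zero, Nat.cast_one, div_one,
      Polynomial.eval_one, mul_one]
    linarith
  | succ k ih =>
    have hk : (-1 : ℝ) < k := by linarith [k.cast_nonneg (α := ℝ)]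
    have h1 := hasDerivAt_volterraMu ht hk hα
    have h2 := (((Real.hasDerivAt_exp t).div_const (k.factorial : ℝ)).mul
      ((residuePoly α k).hasDerivAt t)).sub (hasDerivAt_generalizedRamanujanN k ht hα0)
    have h3 := h2.congr_of_eventuallyEq (f₁ := fun t => volterraMu t k α) (by
      filter_upwards [lt_mem_nhds ht] with s hs using ih hs)
    -- Two expressions for the derivative of μ(·,k,α): one contains μ(t,k+1,α), the other
    -- N_{k+1}(t,α) and P_k'. Solving for μ(t,k+1,α) gives the next case.
    have h := h1.unique h3
    rw [ih ht] at h
    have hf : (k.factorial : ℝ) ≠ 0 := Nat.cast_ne_zero.2 k.factorial_ne_zero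
    have hk1 : (k : ℝ) + 1 ≠ 0 := by linarith
    have ht' := ht.ne'
    simp only [residuePoly, Nat.factorial_succ, Polynomial.eval_sub, Polynomial.eval_mul,
      Polynomial.eval_add, Polynomial.eval_X, Polynomial.eval_C]
    push_cast
    apply mul_left_cancel₀ hk1
    field_simp at h ⊢
    linear_combination h

theorem generalizedRamanujanN_zero_zero (t : ℝ) :
    generalizedRamanujanN 0 t 0 = ramanujanN t := by
  rw [generalizedRamanujanN_eq, ramanujanN, ← integral_const_mul]
  refine setIntegral_congr_fun measurableSet_Ioi fun r _ => ?_
  have := Real.pi_ne_zero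
  simp only [ramanujanKernel_zero_zero]
  field_simp

theorem theorem3p1 :
    (∀ (k : ℕ) (α : ℝ), -1 < α → α ≤ 0 →
      ∃ P : Polynomial ℝ,
        P.degree = (k : WithBot ℕ) ∧
        (∀ t : ℝ, HasResidueAt
          (fun s : ℂ => Complex.exp (s * (t : ℂ)) * volterraLaplace s k α) 1
          ((Real.exp t / (k.factorial : ℝ) * P.eval t : ℝ) : ℂ)) ∧
        (∀ t : ℝ, 0 < t →
          IntegrableOn (volterraIntegrand t (k : ℝ) α) (Ioi 0) ∧
          IntegrableOn (ramanujanIntegrand k t α) (Ioi 0) ∧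
          volterraMu t (k : ℝ) α =
            Real.exp t / (k.factorial : ℝ) * P.eval t - generalizedRamanujanN k t α)) ∧
    (∀ t : ℝ, 0 < t →
      generalizedRamanujanN 0 t 0 = ramanujanN t ∧
      volterraNu t = Real.exp t - ramanujanN t) := by
  refine ⟨fun k α hα hα0 => ⟨residuePoly α k, degree_residuePoly α k,
    hasResidueAt_exp_mul_volterraLaplace k α, fun t ht => ⟨?_, ?_, ?_⟩⟩, fun t ht => ?_⟩
  · exact integrableOn_volterraIntegrand ht (by linarith [k.cast_nonneg (α := ℝ)]) hα.le
  · exact integrableOn_ramanujanIntegrand k ht hα0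
  · exact volterraMu_eq k hα.le hα0 ht
  · refine ⟨generalizedRamanujanN_zero_zero t, ?_⟩
    rw [← generalizedRamanujanN_zero_zero, volterraNu, ← volterraMu_zero_zero ht]
    ring
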